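/- For a finite graph $G$, a set $S$ of vertices is resolving if every vertex of $G$ is determined by its distances to the members of $S$, and the metric dimension $\beta(G)$ is the least cardinality of a resolving set (vertices in different components are at distance $\infty$). The Kneser graph $K(k,n)$, for $n>k\ge 1$, has the $k$-subsets of $[n]$ as vertices, two of them being adjacent when they are disjoint. A Berge cycle of length $\ell\ge 2$ in a hypergraph consists of distinct vertices $v_1,\dots,v_\ell$ and distinct hyperedges $e_1,\dots,e_\ell$ with $v_i,v_{i+1}\in e_i$ (indices modulo $\ell$); the girth is the least length of a Berge cycle. By an $H(k,5)$ we mean a finite, $k$-uniform, $\lceil k/2+1\rceil$-regular hypergraph of girth $5$. For a set $B$ of $k'\le k$ vertices of a hypergraph with hyperedges of cardinality at most $k$, the entry of the detection vector of $B$ at a hyperedge $h$ is $0$ if $h\cap B=\emptyset$, is $k$ if $|h\cap B|=k$, and is $1$ otherwise; the hypergraph is $k'$-detectable if distinct $k'$-sets of vertices have distinct detection vectors. Let $k\ge 3$. An $H(k,5)$ exists. Every $H(k,5)$ is $k'$-detectable for all $0\le k'\le k$. If some $H(k,5)$ has $m$ vertices, $n\ge m$, and $n'$ is the smallest non-negative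 integer with $n'\equiv n \pmod m$, then $$\beta(K(k,n))\le\left(\frac12+\frac1k\right)n+\left(\frac12+\frac1k\right)m\left\lceil\frac{n'}{m}\right\rceil\quad\text{for even }k\ge 4,$$ $$\beta(K(k,n))\le\left(\frac12+\frac1k\right)n+\frac{1}{2k}\,n+\left(\frac12+\frac1k+\frac1{2k}\right)m\left\lceil\frac{n'}{m}\right\rceil\quad\text{for odd }k\ge 3.$$ Consequently there is a constant $C$ depending only on $k$ such that, for all $n>k$, $\beta(K(k,n))\le\left(\frac12+\frac1k\right)n+C$ if $k\ge 4$ is even, and $\beta(K(k,n))\le\left(\frac12+\frac1k+\frac1{2k}\right)n+C$ if $k\ge 3$ is odd. -/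

import Mathlib

namespace SimpleGraph

/-- A finite set `S` of vertices is resolving if every vertex is determined by its distances
to the vertices of `S` (vertices in different components are at distance `⊤`). -/
def IsResolving {V : Type*} (G : SimpleGraph V) (S : Finset V) : Prop :=
  ∀ u v : V, (∀ s ∈ S, G.edist s u = G.edist s v) → u = v

/-- The metric dimension of a finite graph: the least cardinality of a resolving set. -/
noncomputable def metricDim {V : Type*} [Finite V] (G : SimpleGraph V) : ℕ :=
  sInf {c : ℕ | ∃ S : Finset V, S.card = c ∧ G.IsResolving S}

/-- The least cardinality in `metricDim` is attained. -/
theorem exists_isResolving_card_eq {V : Type*} [Finite V] (G : SimpleGraph V) :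
    ∃ S : Finset V, S.card = G.metricDim ∧ G.IsResolving S := by
  have : Fintype V := Fintype.ofFinite V
  refine Nat.sInf_mem (s := {c : ℕ | ∃ S : Finset V, S.card = c ∧ G.IsResolving S})
    ⟨Finset.univ.card, Finset.univ, rfl, fun u v h => ?_⟩
  have h1 := h u (Finset.mem_univ u)
  rw [edist_self] at h1
  exact edist_eq_zero_iff.mp h1.symm

/-- The Kneser graph `K(k, n)`: the vertices are the `k`-element subsets of an `n`-element set,
and two (distinct) vertices are adjacent when they are disjoint. -/
def kneser (k n : ℕ) : SimpleGraph {s : Finset (Fin n) // s.card = k} where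
  Adj s t := s ≠ t ∧ Disjoint s.1 t.1
  symm := ⟨fun _ _ h => ⟨h.1.symm, h.2.symm⟩⟩
  loopless := ⟨fun _ h => h.1 rfl⟩

end SimpleGraph

namespace Hypergraph

variable {α : Type*}

/-- Every hyperedge has exactly `k` vertices. -/
def IsUniform (H : Hypergraph α) (k : ℕ) : Prop :=
  ∀ e ∈ H.edgeSet, e.encard = k

/-- Every vertex lies in exactly `r` hyperedges. -/
def IsRegular (H : Hypergraph α) (r : ℕ) : Prop :=
  ∀ v ∈ H.vertexSet, {e ∈ H.edgeSet | v ∈ e}.encard = r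

/-- A Berge cycle of length `l ≥ 2`: distinct vertices `v 0, …, v (l - 1)` and distinct hyperedges
`e 0, …, e (l - 1)` such that `e i` contains `v i` and the cyclically next vertex `v (i + 1)`. -/
def HasBergeCycle (H : Hypergraph α) (l : ℕ) : Prop :=
  2 ≤ l ∧ ∃ (v : Fin l → α) (e : Fin l → Set α),
    Function.Injective v ∧ Function.Injective e ∧
      ∀ i, e i ∈ H.edgeSet ∧ v i ∈ e i ∧ v (finRotate l i) ∈ e i

/-- The length of a shortest Berge cycle (`⊤` if there is none). -/
noncomputable def girth (H : Hypergraph α) : ℕ∞ :=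
  ⨅ (l : ℕ) (_ : H.HasBergeCycle l), (l : ℕ∞)

/-- The entry of the detection vector of `B` at the hyperedge `e`: it is `0`, `k` or `1` according
to whether `e` contains no vertex of `B`, exactly `k` vertices of `B`, or another number. -/
noncomputable def detection (k : ℕ) (B : Finset α) (e : Set α) : ℕ :=
  if (↑B ∩ e).ncard = 0 then 0 else if (↑B ∩ e).ncard = k then k else 1

/-- `k'`-detectability of a hypergraph with hyperedges of at most `k` vertices: different sets of
`k'` vertices have different detection vectors. -/
def IsDetectable (H : Hypergraph α) (k k' : ℕ) : Prop :=
  ∀ B₁ B₂ : Finset α, ↑B₁ ⊆ H.vertexSet → ↑B₂ ⊆ H.vertexSet → B₁.card = k' → B₂.card = k' →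
    (∀ e ∈ H.edgeSet, detection k B₁ e = detection k B₂ e) → B₁ = B₂

/-- `H` is an `H(k, 5)`: a finite, `k`-uniform, `⌈k/2 + 1⌉`-regular hypergraph of girth `5`. -/
structure IsHk5 (k : ℕ) (H : Hypergraph α) : Prop where
  finite : H.vertexSet.Finite
  uniform : H.IsUniform k
  regular : H.IsRegular ⌈(k : ℚ) / 2 + 1⌉₊
  girth_eq : H.girth = 5

end Hypergraph

/-! Only the zero entries of a detection vector are needed, that is, which hyperedges `B` meets.
Write `r` for the degree, so that `2 * r ≥ k + 2`. Suppose incomparable sets `B₁`, `B₂` meet the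
same hyperedges, with `B₁.card ≤ k`. Around a point of `B₁ \ B₂` and a point of `B₂ \ B₁`, girth at
least 5 keeps the meeting points on different edges apart, and `B₁` is forced to contain `2 * r - 1
> k` points (`ShortCycleFree.subset_or_subset`).

Existence: lift the complete bipartite graph on `k + r` vertices by voltages in a power of `ZMod 25`
that are generic except for one relation, carried by a closed walk of length 10. Shorter
non-backtracking closed walks have non-zero voltage, so the shortest Berge cycles of the lift have
length exactly 5 (`girth_lift`).

Upper bound: in the Kneser graph disjointness means distance 1, so a family of `k`-sets resolves as
soon as its disjointness pattern separates `k`-sets. Split `[n]` into `n / m` copies of the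
hypergraph and `n % m` leftover points. By double counting each copy costs `r * m / k` sets. The
leftover points are placed in a `k × p` grid and located individually by the lines of `k + 1` slopes
(`exists_lines`). The Moore-type bound `mul_le_ncard_vertexSet` makes `m` large enough for these
lines to cost at most `r * (m + n % m) / k` (`exists_modulus`). -/

namespace Hypergraph

/-! ### Detectability from the absence of short Berge cycles. -/

/-- A family of sets without Berge cycles of length `2`, `3` or `4`. -/
structure ShortCycleFree {V : Type*} (E : Set (Set V)) : Prop where
  two : ∀ e ∈ E, ∀ f ∈ E, ∀ a b, a ≠ b → a ∈ e → b ∈ e → a ∈ f → b ∈ f → e = f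
  three : ∀ e ∈ E, ∀ f ∈ E, ∀ g ∈ E, ∀ a b c, a ≠ b → b ≠ c → c ≠ a → e ≠ f → f ≠ g → g ≠ e →
    a ∈ e → b ∈ e → b ∈ f → c ∈ f → c ∈ g → a ∈ g → False
  four : ∀ e ∈ E, ∀ f ∈ E, ∀ g ∈ E, ∀ h ∈ E, ∀ a b c d, a ≠ b → b ≠ c → c ≠ d → d ≠ a → a ≠ c →
    b ≠ d → e ≠ f → f ≠ g → g ≠ h → h ≠ e → e ≠ g → f ≠ h →
    a ∈ e → b ∈ e → b ∈ f → c ∈ f → c ∈ g → d ∈ g → d ∈ h → a ∈ h → False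

theorem not_hasBergeCycle_of_lt_girth {α : Type*} {H : Hypergraph α} {l : ℕ}
    (h : (l : ℕ∞) < H.girth) : ¬ H.HasBergeCycle l := fun hl =>
  absurd (iInf₂_le (f := fun (l : ℕ) (_ : H.HasBergeCycle l) => (l : ℕ∞)) l hl) (not_le.mpr h)

theorem shortCycleFree_edgeSet {α : Type*} {H : Hypergraph α} (h : 5 ≤ H.girth) :
    ShortCycleFree H.edgeSet := by
  have key : ∀ l : ℕ, l < 5 → ¬ H.HasBergeCycle l := fun l hl =>
    not_hasBergeCycle_of_lt_girth (lt_of_lt_of_le (by exact_mod_cast hl) h)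
  refine ⟨?_, ?_, ?_⟩
  · intro e he f hf a b hab h1 h2 h3 h4
    by_contra hef
    refine key 2 (by norm_num) ⟨le_rfl, ![a, b], ![e, f], ?_, ?_, ?_⟩
    · intro i j; fin_cases i <;> fin_cases j <;> simp [hab, hab.symm]
    · intro i j; fin_cases i <;> fin_cases j <;> simp [hef, Ne.symm hef]
    · intro i; fin_cases i <;> simp [*]
  · intro e he f hf g hg a b c hab hbc hca hef hfg hge h1 h2 h3 h4 h5 h6
    refine key 3 (by norm_num) ⟨by norm_num, ![a, b, c], ![e, f, g], ?_, ?_, ?_⟩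
    · intro i j
      fin_cases i <;> fin_cases j <;> simp [hab, hab.symm, hbc, hbc.symm, hca, hca.symm]
    · intro i j
      fin_cases i <;> fin_cases j <;> simp [hef, hef.symm, hfg, hfg.symm, hge, hge.symm]
    · intro i; fin_cases i <;> simp [*]
  · intro e he f hf g hg h hh a b c d hab hbc hcd hda hac hbd hef hfg hgh hhe heg hfh
      h1 h2 h3 h4 h5 h6 h7 h8
    refine key 4 (by norm_num) ⟨by norm_num, ![a, b, c, d], ![e, f, g, h], ?_, ?_, ?_⟩
    · intro i j
      fin_cases i <;> fin_cases j <;> simp [hab, hab.symm, hbc, hbc.symm, hcd, hcd.symm, hda,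
        hda.symm, hac, hac.symm, hbd, hbd.symm]
    · intro i j
      fin_cases i <;> fin_cases j <;> simp [hef, hef.symm, hfg, hfg.symm, hgh, hgh.symm, hhe,
        hhe.symm, heg, heg.symm, hfh, hfh.symm]
    · intro i; fin_cases i <;> simp [*]

section Core

variable {V : Type*} {E : Set (Set V)}

/-- Representatives in different edges through `x` are different. -/
theorem ShortCycleFree.injective_of_mem (hE : ShortCycleFree E) {ι : Type*} {x : V}
    {e : ι → Set V} (he : Function.Injective e) (heE : ∀ i, e i ∈ E) (hx : ∀ i, x ∈ e i)
    {w : ι → V} (hw : ∀ i, w i ∈ e i) (hne : ∀ i, w i ≠ x) : Function.Injective w := by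
  intro i j hij
  exact he (hE.two _ (heE i) _ (heE j) x (w i) (hne i).symm (hx i) (hw i) (hx j) (hij ▸ hw j))

/-- If `B₁` and `B₂` meet the same edges, then every representative in `B₂` of an edge through a
point of `B₁ \ B₂` belongs to `B₁`. -/
theorem ShortCycleFree.mem_of_mem_edge (hE : ShortCycleFree E) {k r : ℕ} (hr : k + 2 ≤ 2 * r)
    {B₁ B₂ : Finset V} (h₁ : B₁.card ≤ k)
    (hB : ∀ e ∈ E, (∃ z ∈ B₂, z ∈ e) → ∃ z ∈ B₁, z ∈ e)
    (hdeg : ∀ z ∈ B₂, z ∉ B₁ → ∃ e : Fin r → Set V, e.Injective ∧ ∀ i, e i ∈ E ∧ z ∈ e i)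
    {x : V} (hx₁ : x ∈ B₁) (hx₂ : x ∉ B₂) {e : Fin r → Set V} (he : e.Injective)
    (heE : ∀ i, e i ∈ E) (hxe : ∀ i, x ∈ e i) {w : Fin r → V} (hwe : ∀ i, w i ∈ e i)
    (hw₂ : ∀ i, w i ∈ B₂) (a : Fin r) : w a ∈ B₁ := by
  classical
  have hwx : ∀ i, w i ≠ x := fun i h => hx₂ (h ▸ hw₂ i)
  have hwinj := hE.injective_of_mem he heE hxe hwe hwx
  -- the points of `B₁` on the edges through `w a` other than `e a`
  have key : ∀ a, w a ∉ B₁ → ∃ U : Finset V, U ⊆ B₁ ∧ r ≤ U.card + 1 ∧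
      ∀ u ∈ U, u ≠ x ∧ u ≠ w a ∧ ∃ f ∈ E, f ≠ e a ∧ w a ∈ f ∧ u ∈ f := by
    intro a ha
    obtain ⟨f, hf, hfE⟩ := hdeg (w a) (hw₂ a) ha
    choose u hu₁ huf using fun j => hB (f j) (hfE j).1 ⟨w a, hw₂ a, (hfE j).2⟩
    have hne : ∀ j, u j ≠ w a := fun j h => ha (h ▸ hu₁ j)
    have huinj := hE.injective_of_mem hf (fun j => (hfE j).1) (fun j => (hfE j).2) huf hne
    refine ⟨(Finset.univ.filter fun j => f j ≠ e a).image u, ?_, ?_, ?_⟩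
    · intro v hv
      obtain ⟨j, -, rfl⟩ := Finset.mem_image.mp hv
      exact hu₁ j
    · rw [Finset.card_image_of_injective _ huinj]
      have h1 := Finset.card_filter_add_card_filter_not (s := (Finset.univ : Finset (Fin r)))
        (fun j => f j ≠ e a)
      have h2 : (Finset.univ.filter fun j => ¬ f j ≠ e a).card ≤ 1 := by
        refine Finset.card_le_one.mpr fun i hi j hj => hf ?_
        simp only [ne_eq, not_not, Finset.mem_filter, Finset.mem_univ, true_and] at hi hj
        rw [hi, hj]
      simp only [Finset.card_univ, Fintype.card_fin] at h1
      omega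
    · intro v hv
      obtain ⟨j, hj, rfl⟩ := Finset.mem_image.mp hv
      have hj' : f j ≠ e a := (Finset.mem_filter.mp hj).2
      refine ⟨fun h => hj' ?_, hne j, f j, (hfE j).1, hj', (hfE j).2, huf j⟩
      exact hE.two _ (hfE j).1 _ (heE a) x (w a) (hwx a).symm (h ▸ huf j) (hfE j).2 (hxe a) (hwe a)
  by_contra ha
  obtain ⟨U, hU₁, hUc, hU⟩ := key a ha
  -- Either way `B₁` receives `x` and two disjoint sets of at least `r - 1` points, hence more than
  -- `k` points: the second set consists of the other `w i`, or of the points found around another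
  -- `w b` outside `B₁`. An overlap would close a Berge cycle of length 3 or 4 through `x`.
  by_cases hall : ∀ i, i ≠ a → w i ∈ B₁
  · have hdis : Disjoint U ((Finset.univ.erase a).image w) := by
      rw [Finset.disjoint_left]
      intro v hvU hvW
      obtain ⟨i, hi, rfl⟩ := Finset.mem_image.mp hvW
      have hia : i ≠ a := (Finset.mem_erase.mp hi).1
      obtain ⟨h1, h2, f, hf, hfa, haf, hif⟩ := hU _ hvU
      refine hE.three (e a) (heE a) f hf (e i) (heE i) x (w a) (w i) (hwx a).symm h2.symm h1
        hfa.symm ?_ (fun h => hia (he h)) (hxe a) (hwe a) haf hif (hwe i) (hxe i)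
      rintro rfl
      exact hia (he (hE.two _ (heE i) _ (heE a) x (w a) (hwx a).symm (hxe i) haf (hxe a) (hwe a)))
    have hsub : insert x (U ∪ (Finset.univ.erase a).image w) ⊆ B₁ := by
      intro v hv
      rcases Finset.mem_insert.mp hv with rfl | hv
      · exact hx₁
      rcases Finset.mem_union.mp hv with hv | hv
      · exact hU₁ hv
      obtain ⟨i, hi, rfl⟩ := Finset.mem_image.mp hv
      exact hall i (Finset.mem_erase.mp hi).1
    have hxn : x ∉ U ∪ (Finset.univ.erase a).image w := by
      intro hv
      rcases Finset.mem_union.mp hv with hv | hv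
      · exact (hU _ hv).1 rfl
      obtain ⟨i, hi, h⟩ := Finset.mem_image.mp hv
      exact hwx i h
    have hc := Finset.card_le_card hsub
    rw [Finset.card_insert_of_notMem hxn, Finset.card_union_of_disjoint hdis,
      Finset.card_image_of_injective _ hwinj, Finset.card_erase_of_mem (Finset.mem_univ _),
      Finset.card_univ, Fintype.card_fin] at hc
    omega
  · push Not at hall
    obtain ⟨b, hba, hb⟩ := hall
    obtain ⟨U', hU'₁, hU'c, hU'⟩ := key b hb
    have hdis : Disjoint U U' := by
      rw [Finset.disjoint_left]
      intro v hvU hvU'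
      obtain ⟨h1, h2, f, hf, hfa, haf, hvf⟩ := hU _ hvU
      obtain ⟨-, h3, g, hg, hgb, hbg, hvg⟩ := hU' _ hvU'
      have hab : w a ≠ w b := fun h => hba (hwinj h).symm
      have heab : e a ≠ e b := fun h => hba (he h).symm
      have hfb : f ≠ e b := by
        rintro rfl
        exact heab (hE.two _ (heE a) _ (heE b) x (w a) (hwx a).symm (hxe a) (hwe a) (hxe b) haf)
      have hga : g ≠ e a := by
        rintro rfl
        exact heab (hE.two _ (heE a) _ (heE b) x (w b) (hwx b).symm (hxe a) hbg (hxe b) (hwe b))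
      by_cases hfg : f = g
      · subst hfg
        exact hE.three (e a) (heE a) f hf (e b) (heE b) x (w a) (w b) (hwx a).symm hab (hwx b)
          hfa.symm hfb heab.symm (hxe a) (hwe a) haf hbg (hwe b) (hxe b)
      · exact hE.four (e a) (heE a) f hf g hg (e b) (heE b) x (w a) v (w b) (hwx a).symm h2.symm h3
          (hwx b) h1.symm hab hfa.symm hfg hgb heab.symm hga.symm hfb (hxe a) (hwe a) haf hvf hvg
          hbg (hwe b) (hxe b)
    have hxn : x ∉ U ∪ U' := by
      intro hv
      rcases Finset.mem_union.mp hv with hv | hv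
      · exact (hU _ hv).1 rfl
      · exact (hU' _ hv).1 rfl
    have hc := Finset.card_le_card
      (Finset.insert_subset hx₁ (Finset.union_subset hU₁ hU'₁))
    rw [Finset.card_insert_of_notMem hxn, Finset.card_union_of_disjoint hdis] at hc
    omega

/-- In a family without short cycles, two incomparable sets, one of them with at most `k` points,
whose differences consist of points of degree at least `k / 2 + 1`, do not meet the same edges. -/
theorem ShortCycleFree.subset_or_subset (hE : ShortCycleFree E) {k r : ℕ} (hr : k + 2 ≤ 2 * r)
    {B₁ B₂ : Finset V} (h₁ : B₁.card ≤ k)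
    (hB : ∀ e ∈ E, (∃ z ∈ B₁, z ∈ e) ↔ ∃ z ∈ B₂, z ∈ e)
    (hdeg₁ : ∀ z ∈ B₁, z ∉ B₂ → ∃ e : Fin r → Set V, e.Injective ∧ ∀ i, e i ∈ E ∧ z ∈ e i)
    (hdeg₂ : ∀ z ∈ B₂, z ∉ B₁ → ∃ e : Fin r → Set V, e.Injective ∧ ∀ i, e i ∈ E ∧ z ∈ e i) :
    B₁ ⊆ B₂ ∨ B₂ ⊆ B₁ := by
  classical
  by_contra hcon
  rw [not_or, Finset.not_subset, Finset.not_subset] at hcon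
  obtain ⟨⟨x, hx₁, hx₂⟩, y, hy₂, hy₁⟩ := hcon
  have hxy : x ≠ y := fun h => hx₂ (h ▸ hy₂)
  obtain ⟨e, he, heE⟩ := hdeg₁ x hx₁ hx₂
  obtain ⟨f, hf, hfE⟩ := hdeg₂ y hy₂ hy₁
  choose w hw₂ hwe using fun j => (hB (e j) (heE j).1).1 ⟨x, hx₁, (heE j).2⟩
  choose u hu₁ huf using fun j => (hB (f j) (hfE j).1).2 ⟨y, hy₂, (hfE j).2⟩
  have hw₁ := hE.mem_of_mem_edge hr h₁ (fun e he => (hB e he).2) hdeg₂ hx₁ hx₂ he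
    (fun i => (heE i).1) (fun i => (heE i).2) hwe hw₂
  have hwx : ∀ i, w i ≠ x := fun i h => hx₂ (h ▸ hw₂ i)
  have huy : ∀ i, u i ≠ y := fun i h => hy₁ (h ▸ hu₁ i)
  have hwy : ∀ i, w i ≠ y := fun i h => hy₁ (h ▸ hw₁ i)
  have hwinj := hE.injective_of_mem he (fun i => (heE i).1) (fun i => (heE i).2) hwe hwx
  have huinj := hE.injective_of_mem hf (fun i => (hfE i).1) (fun i => (hfE i).2) huf huy
  -- Two common points together with `x` and `y` would span a Berge cycle of length 4, or of length
  -- 3 when an edge through `x` is also an edge through `y`.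
  have hcap : (Finset.univ.image w ∩ Finset.univ.image u).card ≤ 1 := by
    refine Finset.card_le_one.mpr fun c hc d hd => ?_
    simp only [Finset.mem_inter, Finset.mem_image, Finset.mem_univ, true_and] at hc hd
    obtain ⟨⟨i, rfl⟩, j, hji⟩ := hc
    obtain ⟨⟨i', rfl⟩, j', hji'⟩ := hd
    by_contra hne
    have hii : e i ≠ e i' := fun h => hne (by rw [he h])
    have hjj : f j ≠ f j' := fun h => hne (by rw [← hji, ← hji', hf h])
    have a1 := heE i
    have a2 := heE i'
    have a3 := hfE j
    have a4 := hfE j'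
    have b1 := hwe i
    have b2 := hwe i'
    have b3 : w i ∈ f j := hji ▸ huf j
    have b4 : w i' ∈ f j' := hji' ▸ huf j'
    have c1 : e i ≠ f j' := fun h =>
      hii (hE.two _ a1.1 _ a2.1 x (w i') (hwx i').symm a1.2 (h ▸ b4) a2.2 b2)
    have c2 : e i' ≠ f j := fun h =>
      hii (hE.two _ a1.1 _ a2.1 x (w i) (hwx i).symm a1.2 b1 a2.2 (h ▸ b3))
    by_cases c3 : e i = f j
    · have hyi : y ∈ e i := c3 ▸ a3.2
      have c4 : e i' ≠ f j' := fun h =>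
        hii (hE.two _ a1.1 _ a2.1 x y hxy a1.2 hyi a2.2 (h ▸ a4.2))
      exact hE.three (e i) a1.1 (f j') a4.1 (e i') a2.1 x y (w i') hxy (hwy i').symm (hwx i')
        c1 c4.symm hii.symm a1.2 hyi a4.2 b4 b2 a2.2
    by_cases c4 : e i' = f j'
    · have hyi : y ∈ e i' := c4 ▸ a4.2
      exact hE.three (e i') a2.1 (f j) a3.1 (e i) a1.1 x y (w i) hxy (hwy i).symm (hwx i)
        c2 (Ne.symm c3) hii a2.2 hyi a3.2 b3 b1 a1.2
    · exact hE.four (e i) a1.1 (f j) a3.1 (f j') a4.1 (e i') a2.1 x (w i) y (w i')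
        (hwx i).symm (hwy i) (hwy i').symm (hwx i') hxy hne c3 hjj (Ne.symm c4) hii.symm c1 c2.symm
        a1.2 b1 b3 a3.2 a4.2 b4 b2 a2.2
  -- The two images have `r` points each and share at most one, so `B₁` would have at least `2 * r -
  -- 1 > k` points.
  have hsub : Finset.univ.image w ∪ Finset.univ.image u ⊆ B₁ := by
    intro v hv
    rcases Finset.mem_union.mp hv with hv | hv <;> obtain ⟨i, -, rfl⟩ := Finset.mem_image.mp hv
    exacts [hw₁ i, hu₁ i]
  have hc := Finset.card_le_card hsub
  have hu := Finset.card_union_add_card_inter (Finset.univ.image w) (Finset.univ.image u)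
  rw [Finset.card_image_of_injective _ hwinj, Finset.card_image_of_injective _ huinj,
    Finset.card_univ, Fintype.card_fin] at hu
  omega

end Core

theorem detection_eq_zero_iff {α : Type*} {k : ℕ} (hk : k ≠ 0) (B : Finset α) (e : Set α) :
    detection k B e = 0 ↔ ¬ ∃ z ∈ B, z ∈ e := by
  have h : (↑B ∩ e).ncard = 0 ↔ ¬ ∃ z ∈ B, z ∈ e := by
    rw [Set.ncard_eq_zero (B.finite_toSet.inter_of_left e), Set.eq_empty_iff_forall_notMem]
    simp
  rw [← h]
  unfold detection
  split_ifs with h1 h2 <;> simp [h1, hk]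

/-- A regular hypergraph has `r` distinct edges through each vertex. -/
theorem IsRegular.exists_edges {α : Type*} {H : Hypergraph α} {r : ℕ} (hH : H.IsRegular r) {v : α}
    (hv : v ∈ H.vertexSet) :
    ∃ e : Fin r → Set α, e.Injective ∧ ∀ i, e i ∈ H.edgeSet ∧ v ∈ e i := by
  have h := hH v hv
  have hfin : {e ∈ H.edgeSet | v ∈ e}.Finite := Set.finite_of_encard_eq_coe h
  have : Fintype {e ∈ H.edgeSet | v ∈ e} := hfin.fintype
  have hc : Fintype.card {e ∈ H.edgeSet | v ∈ e} = r := by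
    rw [← Nat.card_eq_fintype_card, Nat.card_coe_set_eq, Set.ncard, h]; rfl
  let φ := (Fintype.equivFinOfCardEq hc).symm
  exact ⟨fun i => φ i, fun i j h => φ.injective (Subtype.ext h), fun i => (φ i).2⟩

theorem isDetectable_of_girth {α : Type*} {H : Hypergraph α} {k k' r : ℕ} (hk : k ≠ 0)
    (hr : k + 2 ≤ 2 * r) (hreg : H.IsRegular r) (hg : 5 ≤ H.girth) (hk' : k' ≤ k) :
    H.IsDetectable k k' := by
  intro B₁ B₂ h₁ h₂ c₁ c₂ hdet
  have hmeet : ∀ e ∈ H.edgeSet, (∃ z ∈ B₁, z ∈ e) ↔ ∃ z ∈ B₂, z ∈ e := fun e he =>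
    not_iff_not.mp (by
      rw [← detection_eq_zero_iff hk, ← detection_eq_zero_iff hk, hdet e he])
  rcases (shortCycleFree_edgeSet hg).subset_or_subset hr (c₁.trans_le hk') hmeet
    (fun z hz _ => hreg.exists_edges (h₁ hz)) (fun z hz _ => hreg.exists_edges (h₂ hz)) with h | h
  · exact Finset.eq_of_subset_of_card_le h (by omega)
  · exact (Finset.eq_of_subset_of_card_le h (by omega)).symm

end Hypergraph

/-! ### Existence of an `H(k, 5)` by a voltage lift. -/

namespace Hypergraph

section Voltage

variable {X Y : Type} [DecidableEq X] [DecidableEq Y]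

/-- The coefficients of the closed walk `a 0, b 0, a 1, b 1, a 2, b 2, a 0, b 0, a 1, b 2` in the
complete bipartite graph on `X` and `Y`. -/
def cycleCoeff (a : Fin 3 → X) (b : Fin 3 → Y) : X × Y → ℤ := fun p =>
  (if p = (a 0, b 0) then 2 else 0) - (if p = (a 1, b 0) then 2 else 0)
    + (if p = (a 1, b 1) then 1 else 0) - (if p = (a 2, b 1) then 1 else 0)
    + (if p = (a 2, b 2) then 1 else 0) + (if p = (a 1, b 2) then 1 else 0)
    - (if p = (a 0, b 2) then 2 else 0)

/-- Voltages that are generic up to the relation `cycleCoeff a b`. -/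
def voltage (a : Fin 3 → X) (b : Fin 3 → Y) (p : X × Y) : X × Y → ZMod 25 := fun q =>
  (if q = p then 1 else 0) - (if p = (a 1, b 1) then (cycleCoeff a b q : ZMod 25) else 0)

/-- The coefficients of a closed walk. -/
def walkCoeff {l : ℕ} (x : Fin l → X) (y : Fin l → Y) : X × Y → ℤ := fun q =>
  ∑ i, ((if q = (x i, y i) then 1 else 0) - (if q = (x (finRotate l i), y i) then 1 else 0))

/-- `voltage a b p` is the image of the unit vector at `p` under the projection `v ↦ v - v (a 1, b
1) • cycleCoeff a b`. For injective `a` and `b`, `cycleCoeff` has coefficient 1 at `(a 1, b 1)`, so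
the kernel of this projection is spanned by `cycleCoeff`. -/
theorem sum_voltage {l : ℕ} (a : Fin 3 → X) (b : Fin 3 → Y) (x : Fin l → X) (y : Fin l → Y)
    (q : X × Y) :
    (∑ i, (voltage a b (x i, y i) - voltage a b (x (finRotate l i), y i))) q =
      ((walkCoeff x y q - walkCoeff x y (a 1, b 1) * cycleCoeff a b q : ℤ) : ZMod 25) := by
  rw [Finset.sum_apply]
  simp only [walkCoeff, voltage, Pi.sub_apply]
  push_cast
  rw [Finset.sum_mul, ← Finset.sum_sub_distrib]
  refine Finset.sum_congr rfl fun i _ => ?_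
  simp only [eq_comm (a := (a 1, b 1))]
  split_ifs <;> ring

/-- This explains the modulus 25: walk coefficients are at most 8 in absolute value, and `8 + 8 * 2
< 25`, so the congruence in `sum_voltage_ne_zero` lifts to an equality of integers. -/
theorem abs_cycleCoeff_le {a : Fin 3 → X} {b : Fin 3 → Y} (ha : a.Injective) (hb : b.Injective)
    (q : X × Y) : |cycleCoeff a b q| ≤ 2 := by
  have h01 : a 0 ≠ a 1 := ha.ne (by decide)
  have h02 : a 0 ≠ a 2 := ha.ne (by decide)
  have h12 : a 1 ≠ a 2 := ha.ne (by decide)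
  have g01 : b 0 ≠ b 1 := hb.ne (by decide)
  have g02 : b 0 ≠ b 2 := hb.ne (by decide)
  have g12 : b 1 ≠ b 2 := hb.ne (by decide)
  obtain ⟨u, v⟩ := q
  unfold cycleCoeff
  simp only [Prod.mk.injEq]
  by_cases h1 : u = a 0
  · subst h1
    by_cases h2 : v = b 0
    · subst h2; simp [h01, h02, g02]
    · simp only [h2, h01, h02, and_false, false_and, if_false, true_and]
      split_ifs <;> norm_num
  by_cases h2 : u = a 1
  · subst h2
    simp only [h01.symm, h12, false_and, if_false, true_and]
    split_ifs <;> simp_all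
  · simp only [h1, h2, false_and, if_false]
    split_ifs <;> norm_num

variable [Fintype X] [Fintype Y]

theorem sum_abs_walkCoeff_le {l : ℕ} (x : Fin l → X) (y : Fin l → Y) :
    ∑ q, |walkCoeff x y q| ≤ 2 * l := by
  calc ∑ q, |walkCoeff x y q|
      ≤ ∑ q : X × Y, ∑ i, ((if q = (x i, y i) then (1 : ℤ) else 0)
          + (if q = (x (finRotate l i), y i) then 1 else 0)) := by
        refine Finset.sum_le_sum fun q _ => (Finset.abs_sum_le_sum_abs _ _).trans
          (Finset.sum_le_sum fun i _ => ?_)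
        split_ifs <;> norm_num
    _ = 2 * l := by
        rw [Finset.sum_comm]
        simp [Finset.sum_add_distrib, mul_comm, ← two_mul]

/-- The total weight 10 exceeds the bound 8 for closed walks with `l ≤ 4`, so the coefficients of
such a walk can only be the zero multiple of `cycleCoeff`. -/
theorem sum_abs_cycleCoeff {a : Fin 3 → X} {b : Fin 3 → Y} (ha : a.Injective)
    (hb : b.Injective) : 10 ≤ ∑ q, |cycleCoeff a b q| := by
  have hinj : Function.Injective (Prod.map a b) := ha.prodMap hb
  calc (10 : ℤ) = ∑ p : Fin 3 × Fin 3, |cycleCoeff a b (Prod.map a b p)| := by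
        simp only [cycleCoeff, Prod.map, Prod.mk.injEq, ha.eq_iff, hb.eq_iff]
        decide
    _ = ∑ q ∈ Finset.univ.map ⟨_, hinj⟩, |cycleCoeff a b q| := by simp
    _ ≤ _ := Finset.sum_le_sum_of_subset_of_nonneg (Finset.subset_univ _) fun _ _ _ => abs_nonneg _

/-- A non-backtracking closed walk of length at most `8` has a non-zero voltage. -/
theorem sum_voltage_ne_zero {a : Fin 3 → X} {b : Fin 3 → Y} (ha : a.Injective)
    (hb : b.Injective) {l : ℕ} (hl : 2 ≤ l) (hl' : l ≤ 4) {x : Fin l → X} {y : Fin l → Y}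
    (hx : ∀ i, x i ≠ x (finRotate l i)) (hy : ∀ i, y i ≠ y (finRotate l i)) :
    ∑ i, (voltage a b (x i, y i) - voltage a b (x (finRotate l i), y i)) ≠ 0 := by
  intro h
  set t := walkCoeff x y (a 1, b 1) with ht
  have hsum := sum_abs_walkCoeff_le x y
  have hle : ∀ q, |walkCoeff x y q| ≤ 8 := fun q =>
    (Finset.single_le_sum (f := fun q => |walkCoeff x y q|) (fun _ _ => abs_nonneg _)
      (Finset.mem_univ q)).trans (hsum.trans (by omega))
  have hmod : ∀ q, walkCoeff x y q = t * cycleCoeff a b q := by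
    intro q
    have h1 := congrFun h q
    rw [sum_voltage, Pi.zero_apply, ZMod.intCast_zmod_eq_zero_iff_dvd] at h1
    refine sub_eq_zero.mp (Int.eq_zero_of_abs_lt_dvd h1 ?_)
    have h2 := abs_sub (walkCoeff x y q) (t * cycleCoeff a b q)
    rw [abs_mul] at h2
    have h3 := mul_le_mul (hle (a 1, b 1)) (abs_cycleCoeff_le ha hb q) (abs_nonneg _) (by norm_num)
    have h4 := hle q
    rw [← ht] at h3
    push_cast
    linarith
  have ht0 : t = 0 := by
    have h1 : ∑ q, |walkCoeff x y q| = |t| * ∑ q, |cycleCoeff a b q| := by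
      rw [Finset.mul_sum]
      exact Finset.sum_congr rfl fun q _ => by rw [hmod, abs_mul]
    have h2 := sum_abs_cycleCoeff ha hb
    have h3 := abs_nonneg t
    by_contra h4
    have h5 : 1 ≤ |t| := Int.one_le_abs h4
    nlinarith
  -- The edge `(x i₀, y i₀)` is never traversed backwards: on a walk this short the reverse
  -- traversal would be so close to step `i₀` that the walk would have to backtrack.
  have hpos : ∀ i₀ : Fin l, (∀ i, i = i₀ ∨ finRotate l i = i₀ ∨ finRotate l (finRotate l i) = i₀ ∨
      i = finRotate l i₀) → 0 < walkCoeff x y (x i₀, y i₀) := by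
    intro i₀ hi₀
    refine Finset.sum_pos' (fun i _ => ?_) ⟨i₀, Finset.mem_univ _, ?_⟩
    · have : (x i₀, y i₀) ≠ (x (finRotate l i), y i) := by
        rw [Ne, Prod.mk.injEq]
        rintro ⟨h1, h2⟩
        rcases hi₀ i with rfl | h3 | h3 | rfl
        · exact hx _ h1
        · exact hy i (by rw [h3, h2])
        · exact hx (finRotate l i) (by rw [h3, h1])
        · exact hy _ h2
      rw [if_neg this]
      split_ifs <;> norm_num
    · have : (x i₀, y i₀) ≠ (x (finRotate l i₀), y i₀) := fun h => hx _ (congrArg Prod.fst h)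
      rw [if_neg this]
      simp
  have hz : ∀ q, walkCoeff x y q = 0 := fun q => by rw [hmod, ht0, zero_mul]
  have hne : ∀ i₀ : Fin l, ¬ ∀ i, i = i₀ ∨ finRotate l i = i₀ ∨
      finRotate l (finRotate l i) = i₀ ∨ i = finRotate l i₀ := fun i₀ h =>
    (hpos i₀ h).ne' (hz _)
  clear * - hne hl hl'
  interval_cases l
  · exact hne 0 (by decide)
  · exact hne 0 (by decide)
  · exact hne 0 (by decide)

end Voltage

section Lift

variable {X Y : Type} [DecidableEq X] [DecidableEq Y]

/-- The points of the hyperedge `(y, g)` of the voltage lift. -/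
def liftEdge (a : Fin 3 → X) (b : Fin 3 → Y) (p : Y × (X × Y → ZMod 25)) :
    Set (X × (X × Y → ZMod 25)) :=
  {v | v.2 + voltage a b (v.1, p.1) = p.2}

/-- The hypergraph of the voltage lift of the complete bipartite graph on `X` and `Y`. -/
def lift (a : Fin 3 → X) (b : Fin 3 → Y) : Hypergraph (X × (X × Y → ZMod 25)) where
  vertexSet := Set.univ
  edgeSet := Set.range (liftEdge a b)
  subset_vertexSet_of_mem_edgeSet' := fun _ _ => Set.subset_univ _

variable [Fintype X] {a : Fin 3 → X} {b : Fin 3 → Y}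

theorem lift_isUniform : (lift a b).IsUniform (Fintype.card X) := by
  rintro _ ⟨⟨y, g⟩, rfl⟩
  have : liftEdge a b (y, g) = (fun x => (x, g - voltage a b (x, y))) '' Set.univ := by
    ext ⟨x, h⟩
    simp [liftEdge, eq_sub_iff_add_eq, eq_comm]
  rw [this, Function.Injective.encard_image (fun x x' h => congrArg Prod.fst h), Set.encard_univ,
    ENat.card_eq_coe_fintype_card]

variable [Fintype Y]

/-- Two hyperedges over different `y`, `y'` with the same points would share points over `a 0` and
`a 1`, giving a closed walk of length 4 with zero voltage. -/
theorem liftEdge_injective (ha : a.Injective) (hb : b.Injective) : (liftEdge a b).Injective := by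
  rintro ⟨y, g⟩ ⟨y', g'⟩ h
  have hmem : ∀ x, g - voltage a b (x, y) + voltage a b (x, y') = g' := by
    intro x
    have h1 : (x, g - voltage a b (x, y)) ∈ liftEdge a b (y, g) := by simp [liftEdge]
    rw [h] at h1
    exact h1
  by_cases hy : y = y'
  · subst hy
    simpa using hmem (a 0)
  · exfalso
    refine sum_voltage_ne_zero ha hb le_rfl (by norm_num) (x := ![a 0, a 1]) (y := ![y, y'])
      ?_ ?_ ?_
    · have : a 0 ≠ a 1 := ha.ne (by decide)
      intro i; fin_cases i <;> simp [this, this.symm]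
    · intro i; fin_cases i <;> simp [hy, Ne.symm hy]
    · have h1 := hmem (a 0)
      have h2 := hmem (a 1)
      rw [← h2] at h1
      have h3 := sub_eq_zero.mpr h1
      rw [Fin.sum_univ_two]
      simp only [finRotate_apply]
      simp
      rw [← neg_eq_zero, ← h3]
      abel

theorem lift_isRegular (ha : a.Injective) (hb : b.Injective) :
    (lift a b).IsRegular (Fintype.card Y) := by
  rintro ⟨x, h⟩ -
  have : {e ∈ (lift a b).edgeSet | (x, h) ∈ e} =
      (fun y => liftEdge a b (y, h + voltage a b (x, y))) '' Set.univ := by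
    ext e
    constructor
    · rintro ⟨⟨⟨y, g⟩, rfl⟩, hg⟩
      exact ⟨y, trivial, congrArg (fun g => liftEdge a b (y, g)) hg⟩
    · rintro ⟨y, -, rfl⟩
      exact ⟨⟨_, rfl⟩, rfl⟩
  rw [this, Function.Injective.encard_image, Set.encard_univ, ENat.card_eq_coe_fintype_card]
  intro y y' hyy
  exact congrArg Prod.fst (liftEdge_injective ha hb hyy)

/-- A Berge cycle projects to a closed walk of zero voltage in the base graph. Two consecutive
vertices on a common hyperedge with the same projection would coincide, and likewise two consecutive
hyperedges through a common vertex, so the walk does not backtrack. -/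
theorem five_le_girth_lift (ha : a.Injective) (hb : b.Injective) : 5 ≤ (lift a b).girth := by
  refine le_iInf₂ fun l hl => ?_
  by_contra hlt
  have hl4 : l ≤ 4 := by
    have : l < 5 := by exact_mod_cast not_le.mp hlt
    omega
  obtain ⟨hl2, v, e, hv, he, h⟩ := hl
  choose p hp using fun i => (h i).1
  have h1 : ∀ i, (v i).2 + voltage a b ((v i).1, (p i).1) = (p i).2 := fun i => by
    have := (h i).2.1
    rwa [← hp i] at this
  have h2 : ∀ i, (v (finRotate l i)).2 + voltage a b ((v (finRotate l i)).1, (p i).1) = (p i).2 :=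
    fun i => by
      have := (h i).2.2
      rwa [← hp i] at this
  have hrot : ∀ i, finRotate l i ≠ i := by
    intro i
    interval_cases l <;> fin_cases i <;> decide
  refine sum_voltage_ne_zero ha hb hl2 hl4 (x := fun i => (v i).1) (y := fun i => (p i).1)
    (fun i hi => ?_) (fun i hi => ?_) ?_
  · refine hrot i (hv (Prod.ext hi.symm ?_))
    have := (h1 i).trans (h2 i).symm
    rw [← hi] at this
    exact (add_right_cancel this).symm
  · refine hrot i (he ?_)
    rw [← hp, ← hp i]
    refine congrArg _ (Prod.ext hi.symm ?_)
    rw [← h1 (finRotate l i), ← h2 i, hi]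
  · have : ∀ i, voltage a b ((v i).1, (p i).1) - voltage a b ((v (finRotate l i)).1, (p i).1) =
        (v (finRotate l i)).2 - (v i).2 := fun i => by
      rw [sub_eq_sub_iff_add_eq_add, add_comm, h1, h2]
    simp only [this]
    rw [Finset.sum_sub_distrib, Equiv.sum_comp (finRotate l) (fun i => (v i).2), sub_self]

/-- The closed walk behind `cycleCoeff` has zero voltage, so it lifts to a closed walk with five
vertices and five hyperedges. -/
theorem hasBergeCycle_lift (ha : a.Injective) (hb : b.Injective) :
    (lift a b).HasBergeCycle 5 := by
  have a01 : a 0 ≠ a 1 := ha.ne (by decide)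
  have a02 : a 0 ≠ a 2 := ha.ne (by decide)
  have a12 : a 1 ≠ a 2 := ha.ne (by decide)
  have b01 : b 0 ≠ b 1 := hb.ne (by decide)
  have b02 : b 0 ≠ b 2 := hb.ne (by decide)
  have b12 : b 1 ≠ b 2 := hb.ne (by decide)
  let w : Fin 3 → Fin 3 → (X × Y → ZMod 25) := fun i j => voltage a b (a i, b j)
  let h₁ := w 0 0 - w 1 0
  let h₂ := h₁ + (w 1 1 - w 2 1)
  let h₃ := h₂ + (w 2 2 - w 0 2)
  let h₄ := h₃ + (w 0 0 - w 1 0)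
  -- `h₃` is the voltage of the hexagon `a 0, b 0, a 1, b 1, a 2, b 2`. That it is non-zero
  -- separates the lifts of the base vertices `a 0`, `a 1`, `b 0`, `b 2`, each visited twice.
  have h3 : h₃ ≠ 0 := by
    have := sum_voltage_ne_zero ha hb (l := 3) (by norm_num) (by norm_num)
      (x := ![a 0, a 1, a 2]) (y := ![b 0, b 1, b 2])
      (by intro i; fin_cases i <;> simp [a01, a12, a02.symm])
      (by intro i; fin_cases i <;> simp [b01, b12, b02.symm])
    rw [Fin.sum_univ_three] at this
    exact this
  have h5 : h₄ + (w 1 2 - w 0 2) = 0 := by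
    funext q
    simp [h₄, h₃, h₂, h₁, w, voltage, cycleCoeff, a01, b01, a12.symm, b12.symm]
    split_ifs <;> ring
  have h41 : h₄ = h₁ + h₃ := by simp only [h₄, h₁]; abel
  refine ⟨by norm_num, ![(a 0, 0), (a 1, h₁), (a 2, h₂), (a 0, h₃), (a 1, h₄)],
    fun i => liftEdge a b (![(b 0, w 0 0), (b 1, h₁ + w 1 1), (b 2, h₂ + w 2 2), (b 0, h₃ + w 0 0),
      (b 2, h₄ + w 1 2)] i), ?_, (liftEdge_injective ha hb).comp ?_, ?_⟩
  · intro i j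
    fin_cases i <;> fin_cases j <;>
      simp [a01, a01.symm, a02, a02.symm, a12, a12.symm, h3, h3.symm, h41]
  · have e1 : h₂ + w 2 2 ≠ h₄ + w 1 2 := by
      intro h
      apply h3
      have e2 : h₄ + w 1 2 = w 0 2 := by
        rw [add_sub, sub_eq_zero] at h5; exact h5
      simp only [h₃, add_sub, h, e2, sub_self]
    intro i j
    fin_cases i <;> fin_cases j <;>
      simp [b01, b01.symm, b02, b02.symm, b12, b12.symm, h3, e1, e1.symm]
  · intro i
    refine ⟨⟨_, rfl⟩, ?_, ?_⟩
    · fin_cases i <;> simp [liftEdge, w]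
    · fin_cases i <;> simp [liftEdge]
      · simp [h₁, w]
      · simp only [h₂, w]; abel
      · simp only [h₃, w]; abel
      · simp only [h₄, w]; abel
      · rw [add_sub, sub_eq_zero] at h5; exact h5.symm

theorem girth_lift (ha : a.Injective) (hb : b.Injective) : (lift a b).girth = 5 :=
  le_antisymm (iInf₂_le (f := fun (l : ℕ) (_ : (lift a b).HasBergeCycle l) => (l : ℕ∞)) 5
    (hasBergeCycle_lift ha hb)) (five_le_girth_lift ha hb)

end Lift

theorem three_le_ceil {k : ℕ} (hk : 3 ≤ k) : 3 ≤ ⌈(k : ℚ) / 2 + 1⌉₊ := by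
  rw [Nat.succ_le_iff, Nat.lt_ceil]
  have : (3 : ℚ) ≤ k := by exact_mod_cast hk
  push_cast
  linarith

theorem exists_isHk5 {k : ℕ} (hk : 3 ≤ k) : ∃ (α : Type) (H : Hypergraph α), H.IsHk5 k := by
  have hr := three_le_ceil hk
  have ha := Fin.castLE_injective hk
  have hb := Fin.castLE_injective hr
  refine ⟨_, lift (Fin.castLE hk) (Fin.castLE hr), Set.toFinite _, ?_, ?_, girth_lift ha hb⟩
  · simpa using lift_isUniform (a := Fin.castLE hk) (b := Fin.castLE hr)
  · simpa using lift_isRegular ha hb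

end Hypergraph

/-! ### Counting vertices and hyperedges. -/

theorem Set.exists_injective_of_encard_eq {α : Type*} {s : Set α} {n : ℕ} (h : s.encard = n) :
    ∃ f : Fin n → α, f.Injective ∧ ∀ i, f i ∈ s := by
  have : Fintype s := (Set.finite_of_encard_eq_coe h).fintype
  have hc : Fintype.card s = n := by
    rw [← Nat.card_eq_fintype_card, Nat.card_coe_set_eq, Set.ncard, h]; rfl
  let φ := (Fintype.equivFinOfCardEq hc).symm
  exact ⟨fun i => φ i, fun i j h => φ.injective (Subtype.ext h), fun i => (φ i).2⟩

theorem Set.exists_injective_of_encard_eq_of_mem {α : Type*} {s : Set α} {n : ℕ}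
    (h : s.encard = n) {a : α} (ha : a ∈ s) :
    ∃ f : Fin (n - 1) → α, f.Injective ∧ ∀ i, f i ∈ s ∧ f i ≠ a := by
  obtain ⟨f, hf, hfs⟩ := Set.exists_injective_of_encard_eq (s := s \ {a}) (n := n - 1) (by
    rw [Set.encard_sdiff_singleton_of_mem ha, h]; norm_cast)
  exact ⟨f, hf, fun i => ⟨(hfs i).1, (hfs i).2⟩⟩

namespace Hypergraph

/-- Counting the points at distance two from a given vertex. -/
theorem mul_le_ncard_vertexSet {α : Type*} {H : Hypergraph α} {k r : ℕ}
    (hfin : H.vertexSet.Finite) (hu : H.IsUniform k) (hreg : H.IsRegular r) (hg : 5 ≤ H.girth)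
    {x : α} (hx : x ∈ H.vertexSet) :
    r * (k - 1) * ((r - 1) * (k - 1)) ≤ H.vertexSet.ncard := by
  have hE := shortCycleFree_edgeSet hg
  obtain ⟨e, he, heE⟩ := Set.exists_injective_of_encard_eq (hreg x hx)
  choose a ha hae using fun i => Set.exists_injective_of_encard_eq_of_mem
    (hu (e i) (heE i).1) (heE i).2
  have haV : ∀ i s, a i s ∈ H.vertexSet := fun i s =>
    H.subset_vertexSet_of_mem_edgeSet' (heE i).1 (hae i s).1
  choose f hf hfE using fun i s => Set.exists_injective_of_encard_eq_of_mem
    (hreg (a i s) (haV i s)) (a := e i) ⟨(heE i).1, (hae i s).1⟩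
  choose b hb hbf using fun i s j => Set.exists_injective_of_encard_eq_of_mem
    (hu (f i s j) (hfE i s j).1.1) (hfE i s j).1.2
  have hbV : ∀ i s j t, b i s j t ∈ H.vertexSet := fun i s j t =>
    H.subset_vertexSet_of_mem_edgeSet' (hfE i s j).1.1 (hbf i s j t).1
  let φ : (Fin r × Fin (k - 1)) × (Fin (r - 1) × Fin (k - 1)) → H.vertexSet :=
    fun p => ⟨b p.1.1 p.1.2 p.2.1 p.2.2, hbV _ _ _ _⟩
  -- Two different paths of length two from `x` to the same endpoint would close a Berge cycle of
  -- length at most 4.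
  have hφ : φ.Injective := by
    rintro ⟨⟨i, s⟩, j, t⟩ ⟨⟨i', s'⟩, j', t'⟩ h
    have hbb : b i s j t = b i' s' j' t' := congrArg Subtype.val h
    obtain ⟨heE1, hxe⟩ := heE i
    obtain ⟨heE1', hxe'⟩ := heE i'
    obtain ⟨hae1, hax⟩ := hae i s
    obtain ⟨hae1', hax'⟩ := hae i' s'
    obtain ⟨⟨hfE1, haf⟩, hfe⟩ := hfE i s j
    obtain ⟨⟨hfE1', haf'⟩, hfe'⟩ := hfE i' s' j'
    obtain ⟨hbf1, hba⟩ := hbf i s j t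
    obtain ⟨hbf1', hba'⟩ := hbf i' s' j' t'
    rw [← hbb] at hbf1' hba'
    by_cases hi : i = i'
    · subst hi
      by_cases hs : s = s'
      · subst hs
        have hj : j = j' := hf i s (hE.two _ hfE1 _ hfE1' _ _ hba hbf1 haf hbf1' haf')
        subst hj
        rw [hb i s j hbb]
      · exfalso
        have haa : a i s ≠ a i s' := fun h => hs (ha i h)
        refine hE.three (e i) heE1 _ hfE1' _ hfE1 (a i s) (a i s') (b i s j t) haa hba'.symm hba
          hfe'.symm (fun h => ?_) hfe hae1 hae1' haf' hbf1' hbf1 haf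
        exact hfe (hE.two _ hfE1 _ heE1 _ _ haa haf (h ▸ haf') hae1 hae1')
    · exfalso
      have hee : e i ≠ e i' := fun h => hi (he h)
      have haa : a i s ≠ a i' s' := fun h =>
        hee (hE.two _ heE1 _ heE1' x (a i s) hax.symm hxe hae1 hxe' (h ▸ hae1'))
      have hbx : b i s j t ≠ x := fun h =>
        hfe (hE.two _ hfE1 _ heE1 x (a i s) hax.symm (h ▸ hbf1) haf hxe hae1)
      have h1 : e i ≠ f i' s' j' := fun h =>
        hee (hE.two _ heE1 _ heE1' x (a i' s') hax'.symm hxe (h ▸ haf') hxe' hae1')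
      have h2 : f i s j ≠ e i' := fun h =>
        hee (hE.two _ heE1 _ heE1' x (a i s) hax.symm hxe hae1 hxe' (h ▸ haf))
      by_cases hff : f i s j = f i' s' j'
      · exact hE.three _ heE1 _ hfE1 _ heE1' x (a i s) (a i' s') hax.symm haa hax' hfe.symm h2
          hee.symm hxe hae1 haf (hff ▸ haf') hae1' hxe'
      · exact hE.four _ heE1 _ hfE1 _ hfE1' _ heE1' x (a i s) (b i s j t) (a i' s') hax.symm
          hba.symm hba' hax' hbx.symm haa hfe.symm hff hfe' hee.symm h1 h2 hxe hae1 haf hbf1 hbf1'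
          haf' hae1' hxe'
  have : Fintype H.vertexSet := hfin.fintype
  have hc := Fintype.card_le_of_injective φ hφ
  rw [← Nat.card_eq_fintype_card (α := H.vertexSet), Nat.card_coe_set_eq] at hc
  simpa using hc

theorem finite_edgeSet {α : Type*} {H : Hypergraph α} (hfin : H.vertexSet.Finite) :
    H.edgeSet.Finite :=
  hfin.powerset.subset fun _ he => H.subset_vertexSet_of_mem_edgeSet' he

theorem ncard_edgeSet_mul {α : Type*} {H : Hypergraph α} {k r : ℕ} (hfin : H.vertexSet.Finite)
    (hu : H.IsUniform k) (hreg : H.IsRegular r) :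
    H.edgeSet.ncard * k = H.vertexSet.ncard * r := by
  classical
  have hE := finite_edgeSet hfin
  rw [Set.ncard_eq_toFinset_card _ hE, Set.ncard_eq_toFinset_card _ hfin]
  refine Finset.card_mul_eq_card_mul (fun e v => v ∈ e) (fun e he => ?_) (fun v hv => ?_)
  · have he' := (Set.Finite.mem_toFinset hE).mp he
    have h := hu e he'
    rw [← Nat.cast_inj (R := ℕ∞), ← h, ← Set.encard_coe_eq_coe_finsetCard]
    congr 1
    ext v
    simpa [Finset.mem_bipartiteAbove] using fun hv => H.subset_vertexSet_of_mem_edgeSet' he' hv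
  · have hv' := (Set.Finite.mem_toFinset hfin).mp hv
    rw [← Nat.cast_inj (R := ℕ∞), ← hreg v hv', ← Set.encard_coe_eq_coe_finsetCard]
    congr 1
    ext e
    simp

end Hypergraph

/-! ### Resolving sets from disjointness patterns, and lines of a grid. -/

/-- Disjointness patterns with the members of a family of `k`-sets bound the metric dimension of the
Kneser graph. -/
theorem SimpleGraph.metricDim_kneser_le {k n : ℕ} (hk : k ≠ 0) {ι : Type*} [Fintype ι]
    (s : ι → Finset (Fin n)) (hs : ∀ i, (s i).card = k)
    (h : ∀ B₁ B₂ : Finset (Fin n), B₁.card = k → B₂.card = k →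
      (∀ i, Disjoint (s i) B₁ ↔ Disjoint (s i) B₂) → B₁ = B₂) :
    (SimpleGraph.kneser k n).metricDim ≤ Fintype.card ι := by
  classical
  let t : ι → {s : Finset (Fin n) // s.card = k} := fun i => ⟨s i, hs i⟩
  -- As `k ≠ 0`, no vertex is disjoint from itself, so disjointness alone gives adjacency.
  have hadj : ∀ i u, (SimpleGraph.kneser k n).Adj (t i) u ↔ Disjoint (s i) u.1 := by
    refine fun i u => ⟨fun h => h.2, fun h => ⟨?_, h⟩⟩
    rintro rfl
    rw [disjoint_self, Finset.bot_eq_empty, ← Finset.card_eq_zero] at h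
    exact hk ((hs i).symm.trans h)
  have hres : (SimpleGraph.kneser k n).IsResolving (Finset.univ.image t) := by
    refine fun u v huv => Subtype.ext ?_
    refine h u v u.2 v.2 fun i => ?_
    rw [← hadj, ← hadj, ← SimpleGraph.edist_eq_one_iff_adj, ← SimpleGraph.edist_eq_one_iff_adj,
      huv (t i) (Finset.mem_image_of_mem t (Finset.mem_univ i))]
  have hle : (SimpleGraph.kneser k n).metricDim ≤ (Finset.univ.image t).card :=
    Nat.sInf_le ⟨_, rfl, hres⟩
  exact hle.trans (Finset.card_image_le.trans_eq Finset.card_univ)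

/-- The lines with slopes `0, …, k` of the grid `Fin k × ZMod p`: through each point of `N` there
are `k + 1` of them, so a set of at most `k` points missing the point misses one of them. -/
theorem exists_lines {β : Type*} [Fintype β] {k p : ℕ} [NeZero p]
    (hp : ∀ a b, 1 ≤ a → a ≤ k → 1 ≤ b → b < k → ¬ p ∣ a * b) (N : Finset β)
    (hN : N.card ≤ k * p) (hβ : k * p ≤ Fintype.card β) :
    ∃ s : Fin (k + 1) × ZMod p → Finset β, (∀ i, (s i).card = k) ∧
      ∀ y ∈ N, ∀ B : Finset β, B.card ≤ k → y ∉ B → ∃ i, y ∈ s i ∧ Disjoint (s i) B := by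
  classical
  -- `N` is padded with arbitrary further points to fill the grid exactly.
  obtain ⟨M, hNM, -, hM⟩ := Finset.exists_subsuperset_card_eq (Finset.subset_univ N) hN hβ
  have hcard : Fintype.card (Fin k × ZMod p) = Fintype.card M := by simp [hM]
  let φ : Fin k × ZMod p ≃ M := Fintype.equivOfCardEq hcard
  have hφ : ∀ {u v}, (φ u : β) = φ v → u = v := fun h => φ.injective (Subtype.ext h)
  refine ⟨fun i => Finset.univ.image fun x : Fin k =>
    (φ (x, ((i.1 : ℕ) : ZMod p) * ((x : ℕ) : ZMod p) + i.2) : β), fun i => ?_, ?_⟩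
  · rw [Finset.card_image_of_injective _ fun x x' h => congrArg Prod.fst (hφ h), Finset.card_univ,
      Fintype.card_fin]
  · intro y hy B hB hyB
    obtain ⟨⟨x₀, t⟩, hx₀⟩ := φ.surjective ⟨y, hNM hy⟩
    have hx₀' : (φ (x₀, t) : β) = y := congrArg Subtype.val hx₀
    let c : Fin (k + 1) → ZMod p := fun σ => t - ((σ : ℕ) : ZMod p) * ((x₀ : ℕ) : ZMod p)
    by_contra hcon
    push Not at hcon
    have hmeet := fun σ => Finset.not_disjoint_iff.mp (hcon (σ, c σ) (by
      rw [Finset.mem_image]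
      exact ⟨x₀, Finset.mem_univ _, by simp [c, hx₀']⟩))
    choose b hbs hbB using hmeet
    have hinj : b.Injective := by
      intro σ τ hστ
      obtain ⟨x, -, hx⟩ := Finset.mem_image.mp (hbs σ)
      obtain ⟨x', -, hx'⟩ := Finset.mem_image.mp (hbs τ)
      have h := hφ ((hx.trans hστ).trans hx'.symm)
      rw [Prod.mk.injEq] at h
      obtain ⟨rfl, h⟩ := h
      by_contra hne
      have hxx : x ≠ x₀ := by
        rintro rfl
        apply hyB
        have : b σ = y := by rw [← hx, ← hx₀']; simp [c]
        exact this ▸ hbB σ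
      -- Lines of slopes `σ` and `τ` through the point in column `x₀` meet again in column `x` only
      -- if `p` divides `(σ - τ) * (x - x₀)`, which `hp` excludes. So the `k + 1` lines would need
      -- `k + 1` different points of `B`.
      have h0 : ((((σ : ℕ) : ℤ) - (τ : ℕ)) * (((x : ℕ) : ℤ) - (x₀ : ℕ)) : ℤ) = ((0 : ℤ) : ZMod p) := by
        push_cast
        simp only [c] at h
        linear_combination h
      rw [Int.cast_zero, ZMod.intCast_zmod_eq_zero_iff_dvd, ← Int.natAbs_dvd_natAbs,
        Int.natAbs_mul, Int.natAbs_natCast] at h0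
      have h1 : (σ : ℕ) ≠ τ := fun h => hne (Fin.ext h)
      have h2 : (x : ℕ) ≠ x₀ := fun h => hxx (Fin.ext h)
      exact hp _ _ (by omega) (by omega) (by omega) (by omega) h0
    have := Finset.card_le_card (Finset.image_subset_iff.mpr fun σ (_ : σ ∈ Finset.univ) => hbB σ)
    rw [Finset.card_image_of_injective _ hinj, Finset.card_univ, Fintype.card_fin] at this
    omega

/-- Here `n` is the number of leftover points. The grid must hold them, its `(k + 1) * p` lines must
fit the budget `r * (m + n) / k`, and `p` must satisfy the divisibility condition of `exists_lines`.
-/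
theorem exists_modulus {k r m n : ℕ} (hk : 3 ≤ k) (hr : k + 2 ≤ 2 * r)
    (hm : r * (k - 1) * ((r - 1) * (k - 1)) ≤ m) (hn : 0 < n) (hnm : n < m) :
    ∃ p, n ≤ k * p ∧ k * (k + 1) * p ≤ r * (m + n) ∧
      ∀ a b, 1 ≤ a → a ≤ k → 1 ≤ b → b < k → ¬ p ∣ a * b := by
  -- every modulus larger than `k * (k - 1)` is admissible
  have hgood : ∀ p, k * (k - 1) < p → ∀ a b, 1 ≤ a → a ≤ k → 1 ≤ b → b < k → ¬ p ∣ a * b := by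
    intro p hp a b ha hak hb hbk hdvd
    have h1 := Nat.le_of_dvd (Nat.mul_pos ha hb) hdvd
    have h2 : a * b ≤ k * (k - 1) := Nat.mul_le_mul hak (by omega)
    omega
  obtain ⟨j, rfl⟩ : ∃ j, k = j + 1 := ⟨k - 1, by omega⟩
  obtain ⟨s, rfl⟩ : ∃ s, r = s + 1 := ⟨r - 1, by omega⟩
  simp only [Nat.add_sub_cancel] at hm hgood
  -- With `k = j + 1`, the choice `p = ⌈n / k⌉` is admissible once it exceeds `k * (k - 1)`.
  have large : (j + 1) * ((j + 1) * j + 1) ≤ n + j →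
      ∃ p, n ≤ (j + 1) * p ∧ (j + 1) * (j + 1 + 1) * p ≤ (s + 1) * (m + n) ∧
        ∀ a b, 1 ≤ a → a ≤ j + 1 → 1 ≤ b → b < j + 1 → ¬ p ∣ a * b := by
    intro h
    refine ⟨(n + j) / (j + 1), ?_, ?_, hgood _ ?_⟩
    · have := Nat.lt_mul_div_succ (n + j) (Nat.succ_pos j)
      rw [mul_add, mul_one] at this
      simp only [Nat.succ_eq_add_one] at this
      omega
    · have h1 := Nat.mul_div_le (n + j) (j + 1)
      have h2 : (j + 2) * (n + j) ≤ (s + 1) * (m + n) := by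
        have h3 : (j + 3) * (m + n) ≤ 2 * ((s + 1) * (m + n)) := by nlinarith
        have h4 : j * (j + 2) ≤ m := by nlinarith
        nlinarith
      calc (j + 1) * (j + 1 + 1) * ((n + j) / (j + 1))
          = (j + 2) * ((j + 1) * ((n + j) / (j + 1))) := by ring
        _ ≤ (j + 2) * (n + j) := Nat.mul_le_mul_left _ h1
        _ ≤ _ := h2
    · rw [← Nat.succ_le_iff, Nat.le_div_iff_mul_le (Nat.succ_pos j), mul_comm]
      exact h
  by_cases hlarge : (j + 1) * ((j + 1) * j + 1) ≤ n + j
  · exact large hlarge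
  -- Otherwise `p = k * (k - 1) + 1` holds all the points, and only the budget remains to be
  -- checked.
  have small : (j + 1) * (j + 1 + 1) * ((j + 1) * j + 1) ≤ (s + 1) * (m + n) →
      ∃ p, n ≤ (j + 1) * p ∧ (j + 1) * (j + 1 + 1) * p ≤ (s + 1) * (m + n) ∧
        ∀ a b, 1 ≤ a → a ≤ j + 1 → 1 ≤ b → b < j + 1 → ¬ p ∣ a * b := fun h =>
    ⟨(j + 1) * j + 1, by omega, h, hgood _ (Nat.lt_succ_self _)⟩
  -- The polynomial inequality `h2` used for large `j` fails below 6. There the Moore bound is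
  -- evaluated at the least `s` allowed by `hs2`, and where needed a smaller modulus 5, 7 or 10 is
  -- taken that divides none of the products `a * b`.
  rcases Nat.lt_or_ge j 6 with hj | hj
  · have h2j : 2 ≤ j := by omega
    have hs2 : j + 1 ≤ 2 * s := by omega
    have hm' : ∀ c, c ≤ s → (c + 1) * j * (c * j) ≤ m := fun c hc => hm.trans' (by gcongr)
    have hr' : ∀ c, c ≤ s → (c + 1) * (m + n) ≤ (s + 1) * (m + n) := fun c hc => by gcongr
    clear hm large
    interval_cases j
    · have h1 := hm' 2 (by omega)
      have h2 := hr' 2 (by omega)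
      by_cases h3 : n ≤ 15
      · refine ⟨5, by omega, by omega, fun a b ha hak hb hbk => ?_⟩
        interval_cases a <;> interval_cases b <;> decide
      · exact small (by omega)
    · have h1 := hm' 2 (by omega)
      have h2 := hr' 2 (by omega)
      by_cases h3 : n ≤ 28
      · refine ⟨7, by omega, by omega, fun a b ha hak hb hbk => ?_⟩
        interval_cases a <;> interval_cases b <;> decide
      by_cases h4 : n ≤ 40
      · refine ⟨10, by omega, by omega, fun a b ha hak hb hbk => ?_⟩
        interval_cases a <;> interval_cases b <;> decide
      · exact small (by omega)
    · have h1 := hm' 3 (by omega)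
      have h2 := hr' 3 (by omega)
      exact small (by omega)
    · have h1 := hm' 3 (by omega)
      have h2 := hr' 3 (by omega)
      by_cases h3 : n ≤ 42
      · refine ⟨7, by omega, by omega, fun a b ha hak hb hbk => ?_⟩
        interval_cases a <;> interval_cases b <;> decide
      · exact small (by omega)
  · apply small
    have h1 : (j + 3) ^ 2 * ((j + 1) * j ^ 2) ≤ 8 * ((s + 1) * m) := by
      calc (j + 3) ^ 2 * ((j + 1) * j ^ 2) ≤ (2 * (s + 1)) ^ 2 * ((2 * s) * j ^ 2) := by
            gcongr <;> omega
        _ = 8 * ((s + 1) * ((s + 1) * j * (s * j))) := by ring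
        _ ≤ _ := by gcongr
    have h2 : 8 * ((j + 2) * (j ^ 2 + j + 1)) ≤ (j + 3) ^ 2 * j ^ 2 := by
      obtain ⟨i, rfl⟩ := Nat.exists_eq_add_of_le hj
      ring_nf
      nlinarith [Nat.zero_le (i ^ 2), Nat.zero_le (i ^ 3), Nat.zero_le (i ^ 4)]
    nlinarith [Nat.mul_le_mul_left (j + 1) h2, Nat.zero_le ((s + 1) * n)]

/-! ### Combining disjoint copies with a locating family. -/

namespace Hypergraph

/-- Disjoint copies of a family without short cycles. -/
theorem ShortCycleFree.copies {α : Type*} {E : Set (Set α)} (hE : ShortCycleFree E) (ι : Type*)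
    (V : Set α) :
    ShortCycleFree (Set.range fun p : ι × E => {v : ι × V | v.1 = p.1 ∧ (v.2 : α) ∈ (p.2 : Set α)})
    where
  two := by
    rintro _ ⟨⟨i, e⟩, rfl⟩ _ ⟨⟨j, f⟩, rfl⟩ ⟨_, a⟩ ⟨_, b⟩ hab ⟨rfl, h1⟩ ⟨rfl, h2⟩ ⟨rfl, h3⟩ ⟨-, h4⟩
    have : (a : α) ≠ b := fun h => hab (by rw [Subtype.ext h])
    have hef : e = f := Subtype.ext (hE.two _ e.2 _ f.2 a b this h1 h2 h3 h4)
    rw [hef]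
  three := by
    rintro _ ⟨⟨i, e⟩, rfl⟩ _ ⟨⟨j, f⟩, rfl⟩ _ ⟨⟨l, g⟩, rfl⟩ ⟨_, a⟩ ⟨_, b⟩ ⟨_, c⟩ hab hbc hca hef hfg hge
      ⟨rfl, h1⟩ ⟨rfl, h2⟩ ⟨rfl, h3⟩ ⟨rfl, h4⟩ ⟨rfl, h5⟩ ⟨-, h6⟩
    refine hE.three _ e.2 _ f.2 _ g.2 a b c (fun h => hab ?_) (fun h => hbc ?_) (fun h => hca ?_)
      (fun h => hef ?_) (fun h => hfg ?_) (fun h => hge ?_) h1 h2 h3 h4 h5 h6 <;>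
    rw [Subtype.ext h]
  four := by
    rintro _ ⟨⟨i, e⟩, rfl⟩ _ ⟨⟨j, f⟩, rfl⟩ _ ⟨⟨l, g⟩, rfl⟩ _ ⟨⟨l', g'⟩, rfl⟩ ⟨_, a⟩ ⟨_, b⟩ ⟨_, c⟩
      ⟨_, d⟩ hab hbc hcd hda hac hbd hef hfg hgh hhe heg hfh
      ⟨rfl, h1⟩ ⟨rfl, h2⟩ ⟨rfl, h3⟩ ⟨rfl, h4⟩ ⟨rfl, h5⟩ ⟨rfl, h6⟩ ⟨rfl, h7⟩ ⟨-, h8⟩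
    refine hE.four _ e.2 _ f.2 _ g.2 _ g'.2 a b c d (fun h => hab ?_) (fun h => hbc ?_)
      (fun h => hcd ?_) (fun h => hda ?_) (fun h => hac ?_) (fun h => hbd ?_)
      (fun h => hef ?_) (fun h => hfg ?_) (fun h => hgh ?_) (fun h => hhe ?_) (fun h => heg ?_)
      (fun h => hfh ?_) h1 h2 h3 h4 h5 h6 h7 h8 <;>
    rw [Subtype.ext h]

/-- Disjoint copies of a hypergraph of girth at least `5` together with a family of sets that
locates the remaining points bound the metric dimension of the Kneser graph. -/
theorem metricDim_kneser_le_of_embedding {α : Type*} {H : Hypergraph α} {k r n q : ℕ} (hk : k ≠ 0)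
    (hr : k + 2 ≤ 2 * r) (hfin : H.vertexSet.Finite) (hu : H.IsUniform k) (hreg : H.IsRegular r)
    (hg : 5 ≤ H.girth) {φ : Fin q × H.vertexSet → Fin n} (hφ : φ.Injective)
    {L : Type*} [Fintype L] {s : L → Finset (Fin n)} (hs : ∀ i, (s i).card = k)
    (hsN : ∀ y, y ∉ Set.range φ → ∀ B : Finset (Fin n), B.card ≤ k → y ∉ B →
      ∃ i, y ∈ s i ∧ Disjoint (s i) B) :
    (SimpleGraph.kneser k n).metricDim ≤ q * H.edgeSet.ncard + Fintype.card L := by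
  classical
  have : Fintype H.vertexSet := hfin.fintype
  have : Fintype H.edgeSet := (finite_edgeSet hfin).fintype
  let t : Fin q × H.edgeSet → Finset (Fin n) := fun p =>
    Finset.univ.filter fun z => ∃ v : H.vertexSet, (v : α) ∈ (p.2 : Set α) ∧ φ (p.1, v) = z
  have ht : ∀ p, (t p).card = k := by
    rintro ⟨i, e, he⟩
    have h1 : ((t (i, ⟨e, he⟩) : Finset (Fin n)) : Set (Fin n)) =
        (fun v => φ (i, v)) '' (Subtype.val ⁻¹' e) := by
      ext z; simp [t]
    rw [← Nat.cast_inj (R := ℕ∞), ← Set.encard_coe_eq_coe_finsetCard, h1,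
      Function.Injective.encard_image fun v w h => congrArg Prod.snd (hφ h),
      Set.encard_preimage_of_injective_subset_range Subtype.val_injective, hu e he]
    rw [Subtype.range_val]
    exact H.subset_vertexSet_of_mem_edgeSet' he
  have hcard : Fintype.card ((Fin q × H.edgeSet) ⊕ L) = q * H.edgeSet.ncard + Fintype.card L := by
    rw [Fintype.card_sum, Fintype.card_prod, Fintype.card_fin,
      ← Nat.card_eq_fintype_card (α := H.edgeSet), Nat.card_coe_set_eq]
  rw [← hcard]
  refine SimpleGraph.metricDim_kneser_le hk (Sum.elim t s) (Sum.rec ht hs) fun B₁ B₂ c₁ c₂ hB => ?_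
  -- Outside the copies the family `s` decides membership point by point, so `B₁` and `B₂` agree
  -- there. Only their traces on the copies are left to compare.
  have hN : ∀ y, y ∉ Set.range φ → (y ∈ B₁ ↔ y ∈ B₂) := by
    intro y hy
    constructor
    · intro h1
      by_contra h2
      obtain ⟨i, hyi, hi⟩ := hsN y hy B₂ c₂.le h2
      exact Finset.disjoint_left.mp ((hB (Sum.inr i)).2 hi) hyi h1
    · intro h1
      by_contra h2
      obtain ⟨i, hyi, hi⟩ := hsN y hy B₁ c₁.le h2
      exact Finset.disjoint_left.mp ((hB (Sum.inr i)).1 hi) hyi h1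
  let pre : Finset (Fin n) → Finset (Fin q × H.vertexSet) := fun B =>
    Finset.univ.filter fun p => φ p ∈ B
  have hpre : ∀ {B p}, p ∈ pre B ↔ φ p ∈ B := by simp [pre]
  have hpc : (pre B₁).card ≤ k := by
    rw [← c₁]
    exact Finset.card_le_card_of_injOn φ (fun p hp => hpre.1 hp) hφ.injOn
  have hmeet : ∀ (B : Finset (Fin n)) (i : Fin q) (e : H.edgeSet),
      (∃ z ∈ pre B, z ∈ {v : Fin q × H.vertexSet | v.1 = i ∧ (v.2 : α) ∈ (e : Set α)}) ↔
        ¬ Disjoint (t (i, e)) B := by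
    intro B i e
    rw [Finset.not_disjoint_iff]
    constructor
    · rintro ⟨⟨_, v⟩, hz, rfl, hv⟩
      exact ⟨_, Finset.mem_filter.mpr ⟨Finset.mem_univ _, v, hv, rfl⟩, hpre.1 hz⟩
    · rintro ⟨z, hz, hzB⟩
      obtain ⟨v, hv, rfl⟩ := (Finset.mem_filter.mp hz).2
      exact ⟨(i, v), hpre.2 hzB, rfl, hv⟩
  have hdeg : ∀ z : Fin q × H.vertexSet, ∃ e : Fin r → Set (Fin q × H.vertexSet), e.Injective ∧
      ∀ i, e i ∈ Set.range (fun p : Fin q × H.edgeSet =>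
        {v : Fin q × H.vertexSet | v.1 = p.1 ∧ (v.2 : α) ∈ (p.2 : Set α)}) ∧ z ∈ e i := by
    rintro ⟨j, v⟩
    obtain ⟨e, he, heE⟩ := hreg.exists_edges v.2
    refine ⟨fun i => {w | w.1 = j ∧ (w.2 : α) ∈ e i}, fun i i' h => he ?_,
      fun i => ⟨⟨(j, ⟨e i, (heE i).1⟩), rfl⟩, rfl, (heE i).2⟩⟩
    have hiff : ∀ w : H.vertexSet, (w : α) ∈ e i ↔ (w : α) ∈ e i' := fun w => by
      have := Set.ext_iff.mp h (j, w)
      simpa using this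
    ext w
    exact ⟨fun hw => (hiff ⟨w, H.subset_vertexSet_of_mem_edgeSet' (heE i).1 hw⟩).1 hw,
      fun hw => (hiff ⟨w, H.subset_vertexSet_of_mem_edgeSet' (heE i').1 hw⟩).2 hw⟩
  have key := ((shortCycleFree_edgeSet hg).copies (Fin q) H.vertexSet).subset_or_subset hr
    (B₂ := pre B₂) hpc (by
      rintro _ ⟨⟨i, e⟩, rfl⟩
      rw [hmeet, hmeet, not_iff_not]
      exact hB (Sum.inl (i, e))) (fun z _ _ => hdeg z) (fun z _ _ => hdeg z)
  have hsub : ∀ {B B' : Finset (Fin n)}, (∀ y, y ∉ Set.range φ → (y ∈ B ↔ y ∈ B')) →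
      pre B ⊆ pre B' → B ⊆ B' := by
    intro B B' h h' y hy
    by_cases hyr : y ∈ Set.range φ
    · obtain ⟨p, rfl⟩ := hyr
      exact hpre.1 (h' (hpre.2 hy))
    · exact (h y hyr).1 hy
  rcases key with h | h
  · exact Finset.eq_of_subset_of_card_le (hsub hN h) (by omega)
  · exact (Finset.eq_of_subset_of_card_le (hsub (fun y hy => (hN y hy).symm) h) (by omega)).symm

theorem exists_mem_vertexSet_of_girth {α : Type*} {H : Hypergraph α} (hg : H.girth = 5) :
    ∃ x, x ∈ H.vertexSet := by
  by_contra hcon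
  have : H.girth = ⊤ := by
    refine iInf₂_eq_top.mpr ?_
    rintro l ⟨hl, v, e, -, -, h⟩
    obtain ⟨h1, h2, -⟩ := h ⟨0, by omega⟩
    exact absurd ⟨_, H.subset_vertexSet_of_mem_edgeSet' h1 h2⟩ hcon
  rw [this] at hg
  exact absurd hg (by decide)

/-- Multiplied by `k`, the copies cost `r * (n - n % m)` by double counting, and the lines, needed
only if `n % m ≠ 0`, cost at most `r * (m + n % m)`. The sum is at most `r * (n + m)`. -/
theorem mul_metricDim_kneser_le {α : Type*} {H : Hypergraph α} {k r n : ℕ} (hk : 3 ≤ k)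
    (hr : k + 2 ≤ 2 * r) (hrk : r ≤ k + 1) (hfin : H.vertexSet.Finite) (hu : H.IsUniform k)
    (hreg : H.IsRegular r) (hg : H.girth = 5) (hn : H.vertexSet.ncard ≤ n) :
    k * (SimpleGraph.kneser k n).metricDim ≤
      r * (n + if n % H.vertexSet.ncard = 0 then 0 else H.vertexSet.ncard) := by
  classical
  have : Fintype H.vertexSet := hfin.fintype
  obtain ⟨x, hx⟩ := exists_mem_vertexSet_of_girth hg
  set m := H.vertexSet.ncard with hm
  have hm0 : 0 < m := (Set.ncard_pos hfin).mpr ⟨x, hx⟩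
  have hmoore : r * (k - 1) * ((r - 1) * (k - 1)) ≤ m :=
    mul_le_ncard_vertexSet hfin hu hreg hg.ge hx
  have hcount : H.edgeSet.ncard * k = m * r := ncard_edgeSet_mul hfin hu hreg
  have hdiv := Nat.div_add_mod n m
  have hq : 1 ≤ n / m := (Nat.one_le_div_iff hm0).mpr hn
  have hcardV : Fintype.card (Fin (n / m) × H.vertexSet) = m * (n / m) := by
    rw [Fintype.card_prod, Fintype.card_fin, ← Nat.card_eq_fintype_card (α := H.vertexSet),
      Nat.card_coe_set_eq, mul_comm]
  obtain ⟨φ⟩ : Nonempty (Fin (n / m) × H.vertexSet ↪ Fin n) :=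
    Function.Embedding.nonempty_of_card_le (by
      rw [hcardV, Fintype.card_fin]; exact Nat.mul_div_le n m)
  have hbudget : k * (n / m * H.edgeSet.ncard) = r * (m * (n / m)) := by
    calc k * (n / m * H.edgeSet.ncard) = n / m * (H.edgeSet.ncard * k) := by ring
      _ = _ := by rw [hcount]; ring
  have hNcard : ((Finset.univ.map φ)ᶜ : Finset (Fin n)).card = n % m := by
    rw [Finset.card_compl, Finset.card_map, Finset.card_univ, hcardV, Fintype.card_fin]
    omega
  have hNmem : ∀ y, y ∉ Set.range φ ↔ y ∈ ((Finset.univ.map φ)ᶜ : Finset (Fin n)) := by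
    intro y; simp
  by_cases h0 : n % m = 0
  · rw [if_pos h0, add_zero]
    have hle := metricDim_kneser_le_of_embedding (by omega) hr hfin hu hreg hg.ge φ.injective
      (L := Fin 0) (s := Fin.elim0) (fun i => i.elim0) (fun y hy => by
        rw [hNmem, Finset.card_eq_zero.mp (hNcard.trans h0)] at hy
        exact absurd hy (Finset.notMem_empty y))
    rw [Fintype.card_fin, add_zero] at hle
    calc _ ≤ _ := Nat.mul_le_mul_left k hle
      _ = _ := hbudget
      _ ≤ _ := Nat.mul_le_mul_left r (Nat.mul_div_le n m)
  · rw [if_neg h0]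
    obtain ⟨p, hp1, hp2, hp3⟩ := exists_modulus hk hr hmoore (Nat.pos_of_ne_zero h0)
      (Nat.mod_lt n hm0)
    have : NeZero p := ⟨by rintro rfl; simp at hp1; omega⟩
    have hmn : m + n % m ≤ n := by nlinarith
    -- The grid may have more cells than there are leftover points; its remaining cells are filled
    -- by points of the copies, so it only has to fit into `Fin n`.
    have hkp : k * p ≤ n := by
      have : (k + 1) * (k * p) ≤ (k + 1) * n := by
        calc (k + 1) * (k * p) = k * (k + 1) * p := by ring
          _ ≤ r * (m + n % m) := hp2
          _ ≤ (k + 1) * n := Nat.mul_le_mul hrk hmn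
      exact Nat.le_of_mul_le_mul_left this (Nat.succ_pos k)
    obtain ⟨s, hs, hsN⟩ := exists_lines hp3 ((Finset.univ.map φ)ᶜ) (hNcard.trans_le hp1)
      (by rwa [Fintype.card_fin])
    have hle := metricDim_kneser_le_of_embedding (by omega) hr hfin hu hreg hg.ge φ.injective hs
      (fun y hy => hsN y ((hNmem y).1 hy))
    rw [Fintype.card_prod, Fintype.card_fin, ZMod.card] at hle
    calc _ ≤ _ := Nat.mul_le_mul_left k hle
      _ = r * (m * (n / m)) + k * (k + 1) * p := by rw [mul_add, hbudget]; ring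
      _ ≤ r * (m * (n / m)) + r * (m + n % m) := Nat.add_le_add_left hp2 _
      _ = r * (n + m) := by
        rw [← mul_add]; congr 1; omega

/-! ### Translation into the real bounds for even and odd `k`. -/

theorem ceil_half_of_even {k : ℕ} (hk : Even k) : (⌈(k : ℚ) / 2 + 1⌉₊ : ℝ) = k / 2 + 1 := by
  obtain ⟨j, rfl⟩ := hk
  have : ⌈((j + j : ℕ) : ℚ) / 2 + 1⌉₊ = j + 1 := by
    rw [← Nat.ceil_natCast (R := ℚ) (j + 1)]
    congr 1
    push_cast
    ring
  rw [this]
  push_cast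
  ring

theorem ceil_half_of_odd {k : ℕ} (hk : Odd k) : (⌈(k : ℚ) / 2 + 1⌉₊ : ℝ) = k / 2 + 3 / 2 := by
  obtain ⟨j, rfl⟩ := hk
  have : ⌈((2 * j + 1 : ℕ) : ℚ) / 2 + 1⌉₊ = j + 2 := by
    rw [Nat.ceil_eq_iff (by omega)]
    push_cast
    constructor <;> linarith
  rw [this]
  push_cast
  ring

theorem add_two_le_two_mul_ceil (k : ℕ) : k + 2 ≤ 2 * ⌈(k : ℚ) / 2 + 1⌉₊ := by
  have h := Nat.le_ceil ((k : ℚ) / 2 + 1)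
  have : ((k + 2 : ℕ) : ℚ) ≤ ((2 * ⌈(k : ℚ) / 2 + 1⌉₊ : ℕ) : ℚ) := by
    push_cast
    linarith
  exact_mod_cast this

theorem ceil_le_add_one {k : ℕ} : ⌈(k : ℚ) / 2 + 1⌉₊ ≤ k + 1 := by
  refine Nat.ceil_le.mpr ?_
  have : (0 : ℚ) ≤ k := Nat.cast_nonneg k
  push_cast
  linarith

theorem IsHk5.metricDim_kneser_le {α : Type*} {H : Hypergraph α} {k n : ℕ} (hk : 3 ≤ k)
    (hH : H.IsHk5 k) (hn : H.vertexSet.ncard ≤ n) :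
    ((SimpleGraph.kneser k n).metricDim : ℝ) ≤ (⌈(k : ℚ) / 2 + 1⌉₊ : ℝ) / k * n +
      (⌈(k : ℚ) / 2 + 1⌉₊ : ℝ) / k * H.vertexSet.ncard *
        (⌈((n % H.vertexSet.ncard : ℕ) : ℝ) / H.vertexSet.ncard⌉ : ℝ) := by
  have h := mul_metricDim_kneser_le hk (add_two_le_two_mul_ceil k) ceil_le_add_one hH.finite
    hH.uniform hH.regular hH.girth_eq hn
  obtain ⟨x, hx⟩ := exists_mem_vertexSet_of_girth hH.girth_eq
  have hm : 0 < H.vertexSet.ncard := (Set.ncard_pos hH.finite).mpr ⟨x, hx⟩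
  have hk0 : (0 : ℝ) < k := by exact_mod_cast (show 0 < k by omega)
  have hceil : ((if n % H.vertexSet.ncard = 0 then 0 else H.vertexSet.ncard : ℕ) : ℝ) ≤
      H.vertexSet.ncard * (⌈((n % H.vertexSet.ncard : ℕ) : ℝ) / H.vertexSet.ncard⌉ : ℝ) := by
    split_ifs with h0
    · simp [h0]
    · have h1 : 0 < ⌈((n % H.vertexSet.ncard : ℕ) : ℝ) / H.vertexSet.ncard⌉ :=
        Int.ceil_pos.mpr (by have := Nat.pos_of_ne_zero h0; positivity)
      have h2 : (1 : ℝ) ≤ (⌈((n % H.vertexSet.ncard : ℕ) : ℝ) / H.vertexSet.ncard⌉ : ℝ) := by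
        exact_mod_cast h1
      exact le_mul_of_one_le_right (Nat.cast_nonneg _) h2
  have h' : (k : ℝ) * (SimpleGraph.kneser k n).metricDim ≤ (⌈(k : ℚ) / 2 + 1⌉₊ : ℝ) *
      (n + ((if n % H.vertexSet.ncard = 0 then 0 else H.vertexSet.ncard : ℕ) : ℝ)) := by
    exact_mod_cast h
  rw [mul_assoc, ← mul_add, div_mul_eq_mul_div, le_div_iff₀ hk0, mul_comm]
  exact h'.trans (by gcongr)

theorem exists_metricDim_kneser_le {k : ℕ} (hk : 3 ≤ k) : ∃ C : ℝ, ∀ n : ℕ,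
    ((SimpleGraph.kneser k n).metricDim : ℝ) ≤ (⌈(k : ℚ) / 2 + 1⌉₊ : ℝ) / k * n + C := by
  obtain ⟨α, H, hH⟩ := exists_isHk5 hk
  obtain ⟨x, hx⟩ := exists_mem_vertexSet_of_girth hH.girth_eq
  have hm : 0 < H.vertexSet.ncard := (Set.ncard_pos hH.finite).mpr ⟨x, hx⟩
  set m := H.vertexSet.ncard with hmdef
  set c : ℝ := (⌈(k : ℚ) / 2 + 1⌉₊ : ℝ) / k with hc
  have hc0 : 0 ≤ c := by positivity
  have hS : ∀ n ∈ Finset.range m, ((SimpleGraph.kneser k n).metricDim : ℝ) ≤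
      ∑ n ∈ Finset.range m, ((SimpleGraph.kneser k n).metricDim : ℝ) := fun n hn =>
    Finset.single_le_sum (f := fun n => ((SimpleGraph.kneser k n).metricDim : ℝ))
      (fun _ _ => Nat.cast_nonneg _) hn
  -- The sum covers the finitely many `n < m`, to which the explicit bound does not apply; `c * m`
  -- bounds its second term for `n ≥ m`, where the ceiling is at most 1.
  refine ⟨c * m + ∑ n ∈ Finset.range m, ((SimpleGraph.kneser k n).metricDim : ℝ), fun n => ?_⟩
  have hcm : 0 ≤ c * m := by positivity
  rcases lt_or_ge n m with h | h
  · have h1 := hS n (Finset.mem_range.mpr h)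
    have h2 : 0 ≤ c * n := by positivity
    linarith
  · have h1 := hH.metricDim_kneser_le hk h
    rw [← hmdef, ← hc] at h1
    have h2 : ⌈((n % m : ℕ) : ℝ) / m⌉ ≤ 1 := by
      rw [Int.ceil_le, Int.cast_one, div_le_one (by exact_mod_cast hm)]
      exact_mod_cast (Nat.mod_lt n hm).le
    have h3 : (⌈((n % m : ℕ) : ℝ) / m⌉ : ℝ) ≤ 1 := by exact_mod_cast h2
    have h4 := mul_le_of_le_one_right hcm h3
    have h5 : 0 ≤ ∑ n ∈ Finset.range m, ((SimpleGraph.kneser k n).metricDim : ℝ) :=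
      Finset.sum_nonneg fun _ _ => Nat.cast_nonneg _
    linarith

end Hypergraph

theorem lemma2p6 (k : ℕ) (hk : 3 ≤ k) :
    -- an `H(k, 5)` exists
    (∃ (α : Type) (H : Hypergraph α), H.IsHk5 k) ∧
    -- every `H(k, 5)` is detectable and gives the explicit bound, `m` being its number of vertices
    (∀ (α : Type*) (H : Hypergraph α) (m : ℕ), H.IsHk5 k → H.vertexSet.ncard = m →
      (∀ k' ≤ k, H.IsDetectable k k') ∧
      (∀ n : ℕ, m ≤ n →
        (Even k → ((SimpleGraph.kneser k n).metricDim : ℝ) ≤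
          (1 / 2 + 1 / (k : ℝ)) * n
            + (1 / 2 + 1 / (k : ℝ)) * m * (⌈((n % m : ℕ) : ℝ) / m⌉ : ℝ)) ∧
        (Odd k → ((SimpleGraph.kneser k n).metricDim : ℝ) ≤
          (1 / 2 + 1 / (k : ℝ)) * n + 1 / (2 * (k : ℝ)) * n
            + (1 / 2 + 1 / (k : ℝ) + 1 / (2 * (k : ℝ))) * m * (⌈((n % m : ℕ) : ℝ) / m⌉ : ℝ)))) ∧
    -- the asymptotic bounds for fixed `k`
    (Even k → ∃ C : ℝ, ∀ n : ℕ, k < n →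
      ((SimpleGraph.kneser k n).metricDim : ℝ) ≤ (1 / 2 + 1 / (k : ℝ)) * n + C) ∧
    (Odd k → ∃ C : ℝ, ∀ n : ℕ, k < n →
      ((SimpleGraph.kneser k n).metricDim : ℝ) ≤
        (1 / 2 + 1 / (k : ℝ) + 1 / (2 * (k : ℝ))) * n + C) := by
  have hk0 : (k : ℝ) ≠ 0 := by exact_mod_cast (show k ≠ 0 by omega)
  have heven : Even k → (⌈(k : ℚ) / 2 + 1⌉₊ : ℝ) / k = 1 / 2 + 1 / (k : ℝ) := fun h => by
    rw [Hypergraph.ceil_half_of_even h]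
    field_simp
  have hodd : Odd k → (⌈(k : ℚ) / 2 + 1⌉₊ : ℝ) / k = 1 / 2 + 1 / (k : ℝ) + 1 / (2 * (k : ℝ)) :=
    fun h => by
      rw [Hypergraph.ceil_half_of_odd h]
      field_simp
      ring
  refine ⟨Hypergraph.exists_isHk5 hk, ?_, fun h => ?_, fun h => ?_⟩
  · rintro α H m hH rfl
    refine ⟨fun k' hk' => Hypergraph.isDetectable_of_girth (by omega)
      (Hypergraph.add_two_le_two_mul_ceil k) hH.regular hH.girth_eq.ge hk', fun n hn => ?_⟩
    have hb := hH.metricDim_kneser_le hk hn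
    refine ⟨fun h => ?_, fun h => ?_⟩
    · rwa [heven h] at hb
    · rw [hodd h] at hb
      linarith
  · obtain ⟨C, hC⟩ := Hypergraph.exists_metricDim_kneser_le hk
    exact ⟨C, fun n _ => heven h ▸ hC n⟩
  · obtain ⟨C, hC⟩ := Hypergraph.exists_metricDim_kneser_le hk
    exact ⟨C, fun n _ => hodd h ▸ hC n⟩
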